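/- Let $\Bbbk$ be a field of characteristic $0$, $I$ a finite set, and $A$ a finitely generated associative unital $\Bbbk$-algebra with a complete family of orthogonal idempotents $(e_s)_{s\in I}$: $e_se_t=\delta_{st}e_s$, $1=\sum_s e_s$; put $B=\bigoplus_s \Bbbk e_s$ and $\otimes=\otimes_\Bbbk$. Let $(A,\{\!\{-,-\}\!\},\Phi)$ be a quasi-Hamiltonian algebra over $B$. This means the following, where Sweedler's notation $d=d'\otimes d''$ is used in $A\otimes A$. (i) $\{\!\{-,-\}\!\}:A\times A\to A\otimes A$ is a $\Bbbk$-bilinear map that vanishes when one argument lies in $B$ and satisfies $\{\!\{a,b\}\!\}=-\{\!\{b,a\}\!\}''\otimes\{\!\{b,a\}\!\}'$ and $\{\!\{a,bc\}\!\}=\{\!\{a,b\}\!\}'\otimes\{\!\{a,b\}\!\}''c+b\{\!\{a,c\}\!\}'\otimes\{\!\{a,c\}\!\}''$. (ii) It is quasi-Poisson: with $\tau(a_1\otimes a_2\otimes a_3)=a_3\otimes a_1\otimes a_2$ and $$\{\!\{a,b,c\}\!\}=\{\!\{a,\{\!\{b,c\}\!\}'\}\!\}\otimes\{\!\{b,c\}\!\}''+\tau\big(\{\!\{b,\{\!\{c,a\}\!\}'\}\!\}\otimes\{\!\{c,a\}\!\}''\big)+\tau^2\big(\{\!\{c,\{\!\{a,b\}\!\}'\}\!\}\otimes\{\!\{a,b\}\!\}''\big),$$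 one has for all $a,b,c\in A$ $$\{\!\{a,b,c\}\!\}=\tfrac14\sum_{s\in I}\big(ce_sa\otimes e_sb\otimes e_s-ce_sa\otimes e_s\otimes be_s-ce_s\otimes ae_sb\otimes e_s+ce_s\otimes ae_s\otimes be_s-e_sa\otimes e_sb\otimes e_sc+e_sa\otimes e_s\otimes be_sc+e_s\otimes ae_sb\otimes e_sc-e_s\otimes ae_s\otimes be_sc\big).$$ (iii) $\Phi\in A^\times\cap\bigoplus_s e_sAe_s$, and $\Phi_s=e_s\Phi e_s$ satisfies $\{\!\{\Phi_s,a\}\!\}=\tfrac12(ae_s\otimes\Phi_s-e_s\otimes\Phi_sa+a\Phi_s\otimes e_s-\Phi_s\otimes e_sa)$ for all $a\in A$, $s\in I$. Let $\alpha\in\mathbb N^I$ and $N=\sum_s\alpha_s$. Let $R=\mathcal O(\operatorname{Rep}(A,\alpha))$ be the commutative $\Bbbk$-algebra generated by symbols $a_{ij}$ ($a\in A$, $1\le i,j\le N$), $\Bbbk$-linear in $a$, with relations $(ab)_{ij}=\sum_l a_{il}b_{lj}$ and such that the matrix $\mathcal X(e_s)$ is the $s$-th diagonal identity block of size $\alpha_s$,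 where $\mathcal X(a)=(a_{ij})$. Let $q=\sum_s q_se_s$ with $q_s\in\Bbbk^\times$, let $J_q\subset R$ be the ideal generated by the entries of $\mathcal X(\Phi)-\mathcal X(q)$, let $R_q=R/J_q$ with projection $r\mapsto\bar r$, and let $R_q^t\subset R_q$ be the subalgebra generated by the elements $\overline{\operatorname{tr}\mathcal X(a)}$, $a\in A$. Then there is a unique antisymmetric biderivation $\{-,-\}$ on $R$ (the quasi-Poisson bracket of $R$) such that $\{a_{ij},b_{kl}\}=\{\!\{a,b\}\!\}'_{kj}\{\!\{a,b\}\!\}''_{il}$ for all $a,b\in A$ and all indices, and $R_q^t$ is a Poisson algebra for the bracket induced by it: there is a unique Poisson bracket $\{-,-\}_q$ on $R_q^t$ such that $\{\bar x,\bar y\}_q=\overline{\{x,y\}}$ for all $x,y\in R$ with $\bar x,\bar y\in R_q^t$. -/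

import Mathlib

open scoped TensorProduct

noncomputable section

namespace QuasiHamiltonian

/-! ## Double brackets, double quasi-Poisson algebras, quasi-Hamiltonian algebras -/

section DoubleBrackets

variable {k : Type*} [Field k] {A : Type*} [Ring A] [Algebra k A] {I : Type*} [Fintype I]

/-- A double bracket on `A` over `B = ⊕ₛ k eₛ`, where `e` is the family of idempotents.
The outer bimodule structure `b · (d' ⊗ d'') · c = b d' ⊗ d'' c` on `A ⊗ A` is
written as multiplication by `b ⊗ 1` on the left and by `1 ⊗ c` on the right. -/
structure IsDoubleBracket (e : I → A) (dbr : A →ₗ[k] A →ₗ[k] A ⊗[k] A) : Prop where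
  cyclic_antisymm : ∀ a b : A, dbr a b = - TensorProduct.comm k A A (dbr b a)
  right_derivation : ∀ a b c : A,
    dbr a (b * c) = dbr a b * ((1 : A) ⊗ₜ[k] c) + (b ⊗ₜ[k] (1 : A)) * dbr a c
  base_left : ∀ (s : I) (a : A), dbr (e s) a = 0
  base_right : ∀ (s : I) (a : A), dbr a (e s) = 0

/-- The cyclic permutation `a₁ ⊗ a₂ ⊗ a₃ ↦ a₃ ⊗ a₁ ⊗ a₂` of `A ⊗ A ⊗ A`. -/
def tau : (A ⊗[k] A) ⊗[k] A →ₗ[k] (A ⊗[k] A) ⊗[k] A :=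
  (TensorProduct.assoc k A A A).symm.toLinearMap ∘ₗ
    (TensorProduct.comm k (A ⊗[k] A) A).toLinearMap

/-- `(a, x' ⊗ x'') ↦ {{a, x'}} ⊗ x''`. -/
def bracketLeft (dbr : A →ₗ[k] A →ₗ[k] A ⊗[k] A) (a : A) :
    A ⊗[k] A →ₗ[k] (A ⊗[k] A) ⊗[k] A :=
  LinearMap.rTensor A (dbr a)

/-- The triple bracket associated with a double bracket. -/
def tripleBracket (dbr : A →ₗ[k] A →ₗ[k] A ⊗[k] A) (a b c : A) : (A ⊗[k] A) ⊗[k] A :=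
  bracketLeft dbr a (dbr b c) + tau (bracketLeft dbr b (dbr c a))
    + tau (tau (bracketLeft dbr c (dbr a b)))

/-- A double quasi-Poisson bracket over `B = ⊕ₛ k eₛ`. -/
structure IsDoubleQuasiPoisson (e : I → A) (dbr : A →ₗ[k] A →ₗ[k] A ⊗[k] A) : Prop
    extends IsDoubleBracket e dbr where
  quasi_poisson : ∀ a b c : A,
    tripleBracket dbr a b c = (1 / 4 : k) • ∑ s : I,
      ((c * e s * a) ⊗ₜ[k] (e s * b) ⊗ₜ[k] (e s)
        - (c * e s * a) ⊗ₜ[k] (e s) ⊗ₜ[k] (b * e s)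
        - (c * e s) ⊗ₜ[k] (a * e s * b) ⊗ₜ[k] (e s)
        + (c * e s) ⊗ₜ[k] (a * e s) ⊗ₜ[k] (b * e s)
        - (e s * a) ⊗ₜ[k] (e s * b) ⊗ₜ[k] (e s * c)
        + (e s * a) ⊗ₜ[k] (e s) ⊗ₜ[k] (b * e s * c)
        + (e s) ⊗ₜ[k] (a * e s * b) ⊗ₜ[k] (e s * c)
        - (e s) ⊗ₜ[k] (a * e s) ⊗ₜ[k] (b * e s * c))

/-- `(A, {{-,-}}, Φ)` is a quasi-Hamiltonian algebra over `B = ⊕ₛ k eₛ`: the double bracket is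
quasi-Poisson and `Φ ∈ ⊕ₛ eₛ A eₛ` is a multiplicative moment map, with components
`Φₛ = eₛ Φ eₛ`. -/
structure IsQuasiHamiltonian (e : I → A) (dbr : A →ₗ[k] A →ₗ[k] A ⊗[k] A) (Φ : A) : Prop
    extends IsDoubleQuasiPoisson e dbr where
  isUnit : IsUnit Φ
  diagonal : Φ = ∑ s : I, e s * Φ * e s
  moment : ∀ (s : I) (a : A),
    dbr (e s * Φ * e s) a = (1 / 2 : k) •
      ((a * e s) ⊗ₜ[k] (e s * Φ * e s) - (e s) ⊗ₜ[k] (e s * Φ * e s * a)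
        + (a * (e s * Φ * e s)) ⊗ₜ[k] (e s) - (e s * Φ * e s) ⊗ₜ[k] (e s * a))

end DoubleBrackets

/-! ## Skew-symmetric biderivations and Poisson brackets on commutative algebras -/

section Brackets

variable {k : Type*} [Field k] {S : Type*} [CommRing S] [Algebra k S]

/-- An antisymmetric biderivation on a commutative algebra. -/
structure IsSkewBiderivation (br : S →ₗ[k] S →ₗ[k] S) : Prop where
  antisymm : ∀ x y : S, br x y = - br y x
  leibniz : ∀ x y z : S, br x (y * z) = br x y * z + y * br x z

/-- A Poisson bracket on a commutative algebra. -/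
structure IsPoissonBracket (br : S →ₗ[k] S →ₗ[k] S) : Prop extends IsSkewBiderivation br where
  jacobi : ∀ x y z : S, br x (br y z) + br y (br z x) + br z (br x y) = 0

end Brackets

/-! ## Representation spaces -/

section RepresentationSpaces

variable (k : Type*) [Field k] {A : Type*} [Ring A] [Algebra k A]
variable {I : Type*} [Fintype I] [DecidableEq I]

/-- The index set `{1, …, N}`, `N = ∑ₛ αₛ`, split in consecutive blocks of sizes `αₛ`:
the pair `⟨s, p⟩` is the `p`-th index of the `s`-th block. -/
abbrev Idx (α : I → ℕ) : Type _ := Σ s : I, Fin (α s)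

/-- The defining relations between the symbols `aᵢⱼ` in the coordinate ring of `Rep(A, α)`:
`k`-linearity in `a`, multiplicativity, and the requirement that the matrix of `eₛ` is the
`s`-th diagonal identity block. -/
inductive RepRel (e : I → A) (α : I → ℕ) : MvPolynomial (A × Idx α × Idx α) k → Prop
  | add (a b : A) (i j : Idx α) : RepRel e α
      (MvPolynomial.X (a + b, i, j) - (MvPolynomial.X (a, i, j) + MvPolynomial.X (b, i, j)))
  | smul (c : k) (a : A) (i j : Idx α) : RepRel e α
      (MvPolynomial.X (c • a, i, j) - c • MvPolynomial.X (a, i, j))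
  | mul (a b : A) (i j : Idx α) : RepRel e α
      (MvPolynomial.X (a * b, i, j)
        - ∑ l : Idx α, MvPolynomial.X (a, i, l) * MvPolynomial.X (b, l, j))
  | idem (s : I) (i j : Idx α) : RepRel e α
      (MvPolynomial.X (e s, i, j) - (if i = j ∧ i.1 = s then 1 else 0))

/-- The coordinate ring `R = O(Rep(A, α))`. -/
abbrev RepRing (e : I → A) (α : I → ℕ) : Type _ :=
  MvPolynomial (A × Idx α × Idx α) k ⧸ Ideal.span {p | RepRel k e α p}

/-- The function `a ↦ aᵢⱼ` from `A` to `R`. -/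
def coord (e : I → A) (α : I → ℕ) (i j : Idx α) : A →ₗ[k] RepRing k e α where
  toFun a := Ideal.Quotient.mk _ (MvPolynomial.X (a, i, j))
  map_add' a b := by
    rw [← map_add]
    exact Ideal.Quotient.eq.2 (Ideal.subset_span (RepRel.add a b i j))
  map_smul' c a :=
    Ideal.Quotient.eq.2 (Ideal.subset_span (RepRel.smul c a i j))

/-- The matrix `𝒳(a) = (aᵢⱼ)` with entries in `R`. -/
def repMatrix (e : I → A) (α : I → ℕ) (a : A) : Matrix (Idx α) (Idx α) (RepRing k e α) :=
  Matrix.of fun i j => coord k e α i j a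

/-- The linear map `A ⊗ A → R`, `d' ⊗ d'' ↦ d'ᵢⱼ d''ᵤᵥ`. -/
def coordMul (e : I → A) (α : I → ℕ) (i j u v : Idx α) : A ⊗[k] A →ₗ[k] RepRing k e α :=
  LinearMap.mul' k (RepRing k e α) ∘ₗ TensorProduct.map (coord k e α i j) (coord k e α u v)

variable {k} in
/-- `br` is the bracket on `R = O(Rep(A, α))` attached to the double bracket `dbr`: it is an
antisymmetric biderivation with `{aᵢⱼ, bₖₗ} = {{a,b}}'ₖⱼ {{a,b}}''ᵢₗ`. -/
structure IsRepBracket (e : I → A) (α : I → ℕ) (dbr : A →ₗ[k] A →ₗ[k] A ⊗[k] A)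
    (br : RepRing k e α →ₗ[k] RepRing k e α →ₗ[k] RepRing k e α) : Prop
    extends IsSkewBiderivation br where
  apply_coord : ∀ (a b : A) (i j u v : Idx α),
    br (coord k e α i j a) (coord k e α u v b) = coordMul k e α u j i v (dbr a b)

variable {k}

/-- The ideal `J_q` of `R` generated by the entries of `𝒳(Φ) - 𝒳(q)`, where `q = ∑ₛ qₛ eₛ`
is an invertible element of `B`. -/
def momentIdeal (e : I → A) (α : I → ℕ) (Φ : A) (q : I → kˣ) : Ideal (RepRing k e α) :=
  Ideal.span {r | ∃ i j : Idx α,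
    r = (repMatrix k e α Φ - repMatrix k e α (∑ s : I, (q s : k) • e s)) i j}

/-- The quotient `R_q = R / J_q`. -/
abbrev RedRing (e : I → A) (α : I → ℕ) (Φ : A) (q : I → kˣ) : Type _ :=
  RepRing k e α ⧸ momentIdeal e α Φ q

/-- The projection `R → R_q`. -/
def redMap (e : I → A) (α : I → ℕ) (Φ : A) (q : I → kˣ) :
    RepRing k e α →ₐ[k] RedRing e α Φ q :=
  Ideal.Quotient.mkₐ k (momentIdeal e α Φ q)

/-- The subalgebra `R_q^t` of `R_q` generated by the classes of the traces `tr 𝒳(a)`, `a ∈ A`. -/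
def traceAlgebra (e : I → A) (α : I → ℕ) (Φ : A) (q : I → kˣ) :
    Subalgebra k (RedRing e α Φ q) :=
  Algebra.adjoin k (Set.range fun a : A => redMap e α Φ q (repMatrix k e α a).trace)

end RepresentationSpaces

end QuasiHamiltonian

end

/-! The bracket on `R` is built by prescribing derivations on the coordinates `aᵢⱼ`: the two
derivation rules of the double bracket match the relation `(ab)ᵢⱼ = ∑ aᵢₗ bₗⱼ`, and its vanishing on
`B` matches the relation for `eₛ` (`IsDoubleBracket.exists_repBracket`).

Jacobi may fail on `R`, but not on traces. There `{tr a, tr b} = tr({{a,b}}'{{a,b}}'')`, so the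
Jacobiator is the trace of the multiplied-out `{{a,b,c}} - {{a,c,b}}`, and the eight quasi-Poisson
terms cancel once multiplied (`IsRepBracket.jacobiator_trCoord`).

Modulo `J_q` the bracket with `Φᵢⱼ` is, up to the scalar `qₛ`, the infinitesimal conjugation action
within a block and zero between blocks (`IsQuasiHamiltonian.map_bracket_moment`). It kills traces
and sends entries of `Φ - q` into `J_q`, so `{J_q, tr} ⊆ J_q` and `{J_q, J_q} ⊆ J_q`. The abstract
reduction `IsSkewBiderivation.existsUnique_reduced` then applies. -/

namespace QuasiHamiltonian

/-! ### Skew biderivations and Poisson reduction. -/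

section Brackets

variable {k : Type*} [Field k] {S : Type*} [CommRing S] [Algebra k S]
  {br : S →ₗ[k] S →ₗ[k] S}

/-- The Jacobiator of a bracket. -/
def jacobiator (br : S →ₗ[k] S →ₗ[k] S) (x y z : S) : S :=
  br x (br y z) + br y (br z x) + br z (br x y)

theorem jacobiator_rotate (x y z : S) : jacobiator br x y z = jacobiator br y z x := by
  unfold jacobiator; ring

namespace IsSkewBiderivation

theorem leibniz_left (h : IsSkewBiderivation br) (x y z : S) :
    br (x * y) z = br x z * y + x * br y z := by
  rw [h.antisymm, h.leibniz, h.antisymm z x, h.antisymm z y]; ring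

theorem map_algebraMap_right (h : IsSkewBiderivation br) (x : S) (c : k) :
    br x (algebraMap k S c) = 0 := by
  have h1 : br x 1 = 0 := by simpa using h.leibniz x 1 1
  rw [Algebra.algebraMap_eq_smul_one, map_smul, h1, smul_zero]

theorem map_algebraMap_left (h : IsSkewBiderivation br) (x : S) (c : k) :
    br (algebraMap k S c) x = 0 := by
  rw [h.antisymm, h.map_algebraMap_right, neg_zero]

/-- The products of two brackets produced by Leibniz cancel in pairs by antisymmetry. With
`jacobiator_rotate`, this makes the Jacobiator a derivation in each slot, hence determined by
generators. -/
theorem jacobiator_mul (h : IsSkewBiderivation br) (x x' y z : S) :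
    jacobiator br (x * x') y z = x * jacobiator br x' y z + x' * jacobiator br x y z := by
  simp only [jacobiator, h.leibniz, h.leibniz_left, map_add]
  rw [h.antisymm z x, h.antisymm z x', h.antisymm y x, h.antisymm y x']
  simp only [map_neg]
  ring

/-- The Jacobiator vanishes on a subalgebra as soon as it vanishes on generators. -/
theorem jacobiator_eq_zero_of_mem_adjoin (h : IsSkewBiderivation br) {s : Set S}
    (hs : ∀ x ∈ s, ∀ y ∈ s, ∀ z ∈ s, jacobiator br x y z = 0) {x y z : S}
    (hx : x ∈ Algebra.adjoin k s) (hy : y ∈ Algebra.adjoin k s) (hz : z ∈ Algebra.adjoin k s) :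
    jacobiator br x y z = 0 := by
  have key : ∀ y z : S, (∀ x ∈ s, jacobiator br x y z = 0) →
      ∀ x ∈ Algebra.adjoin k s, jacobiator br x y z = 0 := by
    intro y z hyz x hx
    induction hx using Algebra.adjoin_induction with
    | mem x hx => exact hyz x hx
    | algebraMap c => simp [jacobiator, h.map_algebraMap_left, h.map_algebraMap_right]
    | add x x' _ _ h1 h2 =>
      have : jacobiator br (x + x') y z = jacobiator br x y z + jacobiator br x' y z := by
        simp only [jacobiator, map_add, LinearMap.add_apply]; ring
      rw [this, h1, h2, add_zero]
    | mul x x' _ _ h1 h2 => rw [h.jacobiator_mul, h1, h2, mul_zero, mul_zero, add_zero]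
  refine key y z (fun x hx => ?_) x hx
  rw [jacobiator_rotate]
  refine key z x (fun y hy => ?_) y hy
  rw [jacobiator_rotate]
  refine key x y (fun z hz => ?_) z hz
  rw [jacobiator_rotate]
  exact hs x hx y hy z hz

/-- A subalgebra is closed under the bracket if the brackets of its generators belong to it. -/
theorem apply_mem_adjoin (h : IsSkewBiderivation br) {s : Set S}
    (hs : ∀ x ∈ s, ∀ y ∈ s, br x y ∈ Algebra.adjoin k s) {x y : S}
    (hx : x ∈ Algebra.adjoin k s) (hy : y ∈ Algebra.adjoin k s) :
    br x y ∈ Algebra.adjoin k s := by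
  have key : ∀ x : S, (∀ y ∈ s, br x y ∈ Algebra.adjoin k s) →
      ∀ y ∈ Algebra.adjoin k s, br x y ∈ Algebra.adjoin k s := by
    intro x hx y hy
    induction hy using Algebra.adjoin_induction with
    | mem y hy => exact hx y hy
    | algebraMap c => rw [h.map_algebraMap_right]; exact zero_mem _
    | add y y' _ _ h1 h2 => rw [map_add]; exact add_mem h1 h2
    | mul y y' hy hy' h1 h2 =>
      rw [h.leibniz]; exact add_mem (mul_mem h1 hy') (mul_mem hy h2)
  refine key x (fun y hy => ?_) y hy
  rw [h.antisymm]
  exact neg_mem (key y (fun x hx => hs y hy x hx) x hx)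

/-- If brackets of `x` with generators of an ideal lie in the ideal, then so do all brackets of
`x` with elements of the ideal. -/
theorem apply_mem_span (h : IsSkewBiderivation br) {g : Set S} {x : S}
    (hg : ∀ y ∈ g, br x y ∈ Ideal.span g) {y : S} (hy : y ∈ Ideal.span g) :
    br x y ∈ Ideal.span g := by
  induction hy using Submodule.span_induction with
  | mem y hy => exact hg y hy
  | zero => rw [map_zero]; exact zero_mem _
  | add y y' _ _ h1 h2 => rw [map_add]; exact add_mem h1 h2
  | smul c y hy h1 =>
    rw [smul_eq_mul, h.leibniz]
    exact add_mem (Ideal.mul_mem_left _ _ hy) (Ideal.mul_mem_left _ _ h1)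

/-- Poisson reduction: let `J` be generated by `g` and let `T` be generated by `s`. If `T` is
closed under the bracket, the Jacobi identity holds on `T`, and the brackets of elements of `g`
with elements of `s` and `g` lie in `J`, then the image of `T` in `S ⧸ J` inherits a unique
Poisson bracket. -/
theorem existsUnique_reduced (h : IsSkewBiderivation br) {s g : Set S} {J : Ideal S}
    (hJ : J = Ideal.span g)
    (hs : ∀ x ∈ s, ∀ y ∈ s, br x y ∈ Algebra.adjoin k s)
    (hjac : ∀ x ∈ s, ∀ y ∈ s, ∀ z ∈ s, jacobiator br x y z = 0)
    (hgs : ∀ x ∈ g, ∀ y ∈ s, br x y ∈ J)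
    (hgg : ∀ x ∈ g, ∀ y ∈ g, br x y ∈ J)
    {T : Subalgebra k (S ⧸ J)}
    (hT : T = (Algebra.adjoin k s).map (Ideal.Quotient.mkₐ k (J))) :
    ∃! pb : T →ₗ[k] T →ₗ[k] T, IsPoissonBracket (k := k) (S := T) pb ∧
      ∀ (x y : S) (hx : Ideal.Quotient.mkₐ k (J) x ∈ T)
        (hy : Ideal.Quotient.mkₐ k (J) y ∈ T),
        ((pb ⟨_, hx⟩ ⟨_, hy⟩ : T) : S ⧸ J) =
          Ideal.Quotient.mkₐ k (J) (br x y) := by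
  set π := Ideal.Quotient.mkₐ k J with hπ
  have hker : ∀ x, π x = 0 ↔ x ∈ J := fun x => Ideal.Quotient.eq_zero_iff_mem
  have lift : ∀ t : T, ∃ x ∈ Algebra.adjoin k s, π x = t := by
    rintro ⟨t, ht⟩
    rw [hT] at ht
    exact ht
  have hspan : ∀ x, (∀ y ∈ g, br x y ∈ J) → ∀ y ∈ J, br x y ∈ J := by
    subst hJ
    exact fun x hx y hy => h.apply_mem_span hx hy
  have hgJ : ∀ x ∈ g, ∀ y ∈ J, br x y ∈ J := fun x hx y hy => hspan x (hgg x hx) y hy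
  have hJJ : ∀ x ∈ J, ∀ y ∈ J, br x y ∈ J := fun x hx y hy => by
    rw [h.antisymm]
    refine neg_mem (hspan y (fun z hz => ?_) x hx)
    rw [h.antisymm]
    exact neg_mem (hgJ z hz y hy)
  have hsJ : ∀ x ∈ Algebra.adjoin k s, ∀ y ∈ J, br x y ∈ J := by
    intro x hx y hy
    induction hx using Algebra.adjoin_induction with
    | mem x hx =>
      refine hspan x (fun z hz => ?_) y hy
      rw [h.antisymm]
      exact neg_mem (hgs z hz x hx)
    | algebraMap c => rw [h.map_algebraMap_left]; exact zero_mem _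
    | add x x' _ _ h1 h2 => rw [map_add, LinearMap.add_apply]; exact add_mem h1 h2
    | mul x x' _ _ h1 h2 =>
      rw [h.leibniz_left]
      exact add_mem (Ideal.mul_mem_right _ _ h1) (Ideal.mul_mem_left _ _ h2)
  -- An arbitrary lift of an element of `T` differs from a lift in the generated subalgebra by an
  -- element of `J`; `hJJ` absorbs this difference.
  have hTJ : ∀ x, π x ∈ T → ∀ y ∈ J, br x y ∈ J := by
    intro x hx y hy
    obtain ⟨t, ht, htx⟩ := lift ⟨_, hx⟩
    have h1 : x - t ∈ J := by rw [← hker, map_sub, htx, sub_self]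
    have h2 : br x y = br (x - t) y + br t y := by simp
    rw [h2]
    exact add_mem (hJJ _ h1 _ hy) (hsJ t ht y hy)
  have wd_right : ∀ x y y', π x ∈ T → π y = π y' → π (br x y) = π (br x y') := by
    intro x y y' hx hyy
    rw [← sub_eq_zero, ← map_sub, ← map_sub, hker]
    refine hTJ x hx _ ?_
    rw [← hker, map_sub, hyy, sub_self]
  have wd : ∀ x x' y y', π x ∈ T → π y ∈ T → π x = π x' → π y = π y' →
      π (br x y) = π (br x' y') := by
    intro x x' y y' hx hy hxx hyy
    rw [wd_right x y y' hx hyy, h.antisymm x, h.antisymm x', map_neg, map_neg,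
      wd_right y' x x' (hyy ▸ hy) hxx]
  -- The section `σ` need not be linear; bilinearity of `pb` comes from independence of lifts, `wd`.
  choose σ hσ hπσ using lift
  have hπT : ∀ t : T, π (σ t) ∈ T := fun t => by rw [hπσ]; exact t.2
  have hbrT : ∀ x ∈ Algebra.adjoin k s, ∀ y ∈ Algebra.adjoin k s, π (br x y) ∈ T := by
    intro x hx y hy
    rw [hT]
    exact ⟨_, h.apply_mem_adjoin hs hx hy, rfl⟩
  let pb : T →ₗ[k] T →ₗ[k] T := LinearMap.mk₂ k
    (fun x y => ⟨π (br (σ x) (σ y)), hbrT _ (hσ x) _ (hσ y)⟩)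
    (fun x x' y => Subtype.ext <| by
      change π (br (σ (x + x')) (σ y)) = π (br (σ x) (σ y)) + π (br (σ x') (σ y))
      rw [← map_add, ← LinearMap.add_apply, ← map_add]
      exact wd _ _ _ _ (hπT _) (hπT _) (by simp [hπσ]) rfl)
    (fun c x y => Subtype.ext <| by
      change π (br (σ (c • x)) (σ y)) = c • π (br (σ x) (σ y))
      rw [← map_smul, ← LinearMap.smul_apply, ← map_smul]
      exact wd _ _ _ _ (hπT _) (hπT _) (by simp [hπσ]) rfl)
    (fun x y y' => Subtype.ext <| by
      change π (br (σ x) (σ (y + y'))) = π (br (σ x) (σ y)) + π (br (σ x) (σ y'))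
      rw [← map_add, ← map_add]
      exact wd _ _ _ _ (hπT _) (hπT _) rfl (by simp [hπσ]))
    (fun c x y => Subtype.ext <| by
      change π (br (σ x) (σ (c • y))) = c • π (br (σ x) (σ y))
      rw [← map_smul, ← map_smul]
      exact wd _ _ _ _ (hπT _) (hπT _) rfl (by simp [hπσ]))
  have hpb : ∀ (x y : S) (hx : π x ∈ T) (hy : π y ∈ T),
      ((pb ⟨_, hx⟩ ⟨_, hy⟩ : T) : S ⧸ J) = π (br x y) := fun x y hx hy =>
    wd _ _ _ _ (hπT _) (hπT _) (hπσ _) (hπσ _)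
  have hpb' : ∀ (x y : T) (a b : S), π a = x → π b = y → (pb x y : S ⧸ J) = π (br a b) := by
    rintro ⟨x, hx⟩ ⟨y, hy⟩ a b rfl rfl
    exact hpb a b hx hy
  refine ⟨pb, ⟨⟨⟨fun x y => ?_, fun x y z => ?_⟩, fun x y z => ?_⟩, hpb⟩, ?_⟩
  · apply Subtype.ext
    change (pb x y : S ⧸ J) = -(pb y x : S ⧸ J)
    rw [hpb' x y _ _ (hπσ x) (hπσ y), hpb' y x _ _ (hπσ y) (hπσ x), h.antisymm, map_neg]
  · apply Subtype.ext
    change (pb x (y * z) : S ⧸ J) = (pb x y : S ⧸ J) * z + y * (pb x z : S ⧸ J)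
    rw [hpb' x (y * z) (σ x) (σ y * σ z) (hπσ x) (by simp [hπσ]),
      hpb' x y _ _ (hπσ x) (hπσ y), hpb' x z _ _ (hπσ x) (hπσ z), h.leibniz, map_add, map_mul,
      map_mul, hπσ, hπσ]
  · apply Subtype.ext
    change (pb x (pb y z) : S ⧸ J) + pb y (pb z x) + pb z (pb x y) = 0
    -- Since `br (σ y) (σ z)` is itself a lift of `pb y z`, the Jacobi identity may be checked on
    -- lifts in the generated subalgebra.
    have h2 : ∀ x y z : T, (pb x (pb y z) : S ⧸ J) = π (br (σ x) (br (σ y) (σ z))) :=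
      fun x y z => hpb' _ _ _ _ (hπσ x) (hpb' _ _ _ _ (hπσ y) (hπσ z)).symm
    rw [h2, h2, h2, ← map_add, ← map_add]
    exact (congrArg π (h.jacobiator_eq_zero_of_mem_adjoin hjac (hσ x) (hσ y) (hσ z))).trans
      (map_zero π)
  · rintro pb' ⟨-, hpb''⟩
    refine LinearMap.ext fun x => LinearMap.ext fun y => Subtype.ext ?_
    rw [hpb' x y _ _ (hπσ x) (hπσ y), ← hpb'' (σ x) (σ y) (hπT x) (hπT y)]
    congr 3 <;> exact Subtype.ext (hπσ _).symm

end IsSkewBiderivation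

end Brackets

/-! ### The derivation rule in the first argument of a double bracket. -/

section DoubleBrackets

variable {k : Type*} [Field k] {A : Type*} [Ring A] [Algebra k A] {I : Type*}
  {e : I → A} {dbr : A →ₗ[k] A →ₗ[k] A ⊗[k] A}

/-- Cyclic antisymmetry swaps the tensor factors, turning the outer bimodule structure into the
inner one. -/
theorem IsDoubleBracket.left_derivation (h : IsDoubleBracket e dbr) (a b c : A) :
    dbr (a * b) c = dbr a c * (b ⊗ₜ[k] (1 : A)) + ((1 : A) ⊗ₜ[k] a) * dbr b c := by
  have hr : ∀ x : A ⊗[k] A, TensorProduct.comm k A A (x * ((1 : A) ⊗ₜ[k] b)) =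
      TensorProduct.comm k A A x * (b ⊗ₜ[k] (1 : A)) := fun x => by
    induction x with
    | zero => simp
    | tmul x y => simp
    | add x y hx hy => simp only [add_mul, map_add, hx, hy]
  have hl : ∀ x : A ⊗[k] A, TensorProduct.comm k A A ((a ⊗ₜ[k] (1 : A)) * x) =
      ((1 : A) ⊗ₜ[k] a) * TensorProduct.comm k A A x := fun x => by
    induction x with
    | zero => simp
    | tmul x y => simp
    | add x y hx hy => simp only [mul_add, map_add, hx, hy]
  rw [h.cyclic_antisymm (a * b), h.right_derivation, map_add, hr, hl, h.cyclic_antisymm a c,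
    h.cyclic_antisymm b c, neg_mul, mul_neg, neg_add]

end DoubleBrackets

/-! ### Coordinates and derivations of `O(Rep(A, α))`. -/

section RepresentationSpaces

variable {k : Type*} [Field k] {A : Type*} [Ring A] [Algebra k A]
variable {I : Type*} [Fintype I] [DecidableEq I] {e : I → A} {α : I → ℕ}

theorem coord_mul (a b : A) (i j : Idx α) :
    coord k e α i j (a * b) = ∑ l, coord k e α i l a * coord k e α l j b := by
  have := (Ideal.Quotient.eq (I := Ideal.span {p | RepRel k e α p})).2
    (Ideal.subset_span (RepRel.mul a b i j))
  rw [map_sum] at this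
  exact this

theorem coord_idem (s : I) (i j : Idx α) :
    coord k e α i j (e s) = if i = j ∧ i.1 = s then 1 else 0 := by
  have := (Ideal.Quotient.eq (I := Ideal.span {p | RepRel k e α p})).2
    (Ideal.subset_span (RepRel.idem s i j))
  rw [apply_ite (Ideal.Quotient.mk _), map_one, map_zero] at this
  exact this

@[simp]
theorem coordMul_tmul (i j u v : Idx α) (a b : A) :
    coordMul k e α i j u v (a ⊗ₜ[k] b) = coord k e α i j a * coord k e α u v b := rfl

theorem adjoin_coord_eq_top :
    Algebra.adjoin k {r : RepRing k e α | ∃ a i j, r = coord k e α i j a} = ⊤ := by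
  have h := congrArg (Subalgebra.map (Ideal.Quotient.mkₐ k (Ideal.span {p | RepRel k e α p})))
    (MvPolynomial.adjoin_range_X (σ := A × Idx α × Idx α) (R := k))
  rw [AlgHom.map_adjoin, Algebra.map_top,
    (AlgHom.range_eq_top _).2 (Ideal.Quotient.mkₐ_surjective k _)] at h
  rw [← h]
  congr 1
  ext r
  constructor
  · rintro ⟨a, i, j, rfl⟩
    exact ⟨_, ⟨(a, i, j), rfl⟩, rfl⟩
  · rintro ⟨_, ⟨⟨a, i, j⟩, rfl⟩, rfl⟩
    exact ⟨a, i, j, rfl⟩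

/-- Derivations out of `O(Rep(A, α))` are prescribed by compatible values on the functions
`aᵢⱼ`. -/
theorem exists_derivation {M : Type*} [AddCommGroup M] [Module k M] [Module (RepRing k e α) M]
    [IsScalarTower k (RepRing k e α) M] (f : Idx α → Idx α → A →ₗ[k] M)
    (hmul : ∀ a b i j, f i j (a * b) =
      ∑ l, (coord k e α i l a • f l j b + coord k e α l j b • f i l a))
    (hidem : ∀ s i j, f i j (e s) = 0) :
    ∃ D : Derivation k (RepRing k e α) M, ∀ i j a, D (coord k e α i j a) = f i j a := by
  let J : Ideal (MvPolynomial (A × Idx α × Idx α) k) := Ideal.span {p | RepRel k e α p}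
  let _ : Module (MvPolynomial (A × Idx α × Idx α) k) M := Module.compHom M (Ideal.Quotient.mk J)
  have smul_def : ∀ (p : MvPolynomial (A × Idx α × Idx α) k) (m : M),
    p • m = (Ideal.Quotient.mk J p : RepRing k e α) • m := fun _ _ => rfl
  have : IsScalarTower k (MvPolynomial (A × Idx α × Idx α) k) M :=
    ⟨fun c p m => by
      rw [smul_def, smul_def, ← smul_assoc]; rfl⟩
  let D₀ : Derivation k (MvPolynomial (A × Idx α × Idx α) k) M :=
    MvPolynomial.mkDerivation k fun x => f x.2.1 x.2.2 x.1
  have hX : ∀ a i j, D₀ (MvPolynomial.X (a, i, j)) = f i j a :=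
    fun a i j => MvPolynomial.mkDerivation_X k _ _
  have hrel : ∀ p, RepRel k e α p → D₀ p = 0 := by
    rintro p (⟨a, b, i, j⟩ | ⟨c, a, i, j⟩ | ⟨a, b, i, j⟩ | ⟨s, i, j⟩)
    · rw [map_sub, map_add, hX, hX, hX, map_add, sub_self]
    · rw [map_sub, D₀.map_smul, hX, hX, map_smul, sub_self]
    · rw [map_sub, map_sum, hX, hmul, sub_eq_zero]
      refine Finset.sum_congr rfl fun l _ => ?_
      rw [D₀.leibniz, hX, hX]
      rfl
    · rw [map_sub, hX, hidem]
      split_ifs <;> simp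
  have hJ : ∀ p ∈ J, D₀ p = 0 := by
    intro p hp
    induction hp using Submodule.span_induction with
    | mem p hp => exact hrel p hp
    | zero => exact map_zero _
    | add p p' _ _ h1 h2 => rw [map_add, h1, h2, add_zero]
    -- In `D₀ (c * p)` the term `p • D₀ c` vanishes because `p` acts on `M` through its class in
    -- `R`, which is zero.
    | smul c p hp h1 =>
      rw [smul_eq_mul, D₀.leibniz, h1, smul_zero, zero_add, smul_def]
      have h0 : (Ideal.Quotient.mk J p : RepRing k e α) = 0 := Ideal.Quotient.eq_zero_iff_mem.2 hp
      rw [h0]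
      exact zero_smul (RepRing k e α) (D₀ c)
  let L : RepRing k e α →ₗ[k] M :=
    Submodule.liftQ (J.restrictScalars k) D₀.toLinearMap hJ
  have hL : ∀ p, L (Ideal.Quotient.mk J p) = D₀ p := fun p => rfl
  refine ⟨Derivation.mk' L fun x y => ?_, fun i j a => ?_⟩
  · obtain ⟨p, rfl⟩ := Ideal.Quotient.mk_surjective x
    obtain ⟨p', rfl⟩ := Ideal.Quotient.mk_surjective y
    rw [← map_mul, hL, hL, hL, D₀.leibniz]
    rfl
  · exact hX a i j

end RepresentationSpaces

/-! ### The bracket on `R` and its restriction to traces. -/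

section RepresentationSpaces

variable {k : Type*} [Field k] {A : Type*} [Ring A] [Algebra k A]
variable {I : Type*} [Fintype I] [DecidableEq I] {e : I → A} {α : I → ℕ}

theorem coordMul_mul_one_tmul (i j u v : Idx α) (x : A ⊗[k] A) (c : A) :
    coordMul k e α i j u v (x * ((1 : A) ⊗ₜ[k] c)) =
      ∑ l, coordMul k e α i j u l x * coord k e α l v c := by
  induction x with
  | zero => simp
  | tmul y z => simp [coord_mul, Finset.mul_sum, mul_assoc]
  | add x y hx hy => simp only [add_mul, map_add, hx, hy, Finset.sum_add_distrib]

theorem coordMul_mul_tmul_one (i j u v : Idx α) (x : A ⊗[k] A) (c : A) :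
    coordMul k e α i j u v (x * (c ⊗ₜ[k] (1 : A))) =
      ∑ l, coordMul k e α i l u v x * coord k e α l j c := by
  induction x with
  | zero => simp
  | tmul y z => simp [coord_mul, Finset.sum_mul, mul_right_comm]
  | add x y hx hy => simp only [add_mul, map_add, hx, hy, Finset.sum_add_distrib]

theorem coordMul_tmul_one_mul (i j u v : Idx α) (x : A ⊗[k] A) (c : A) :
    coordMul k e α i j u v ((c ⊗ₜ[k] (1 : A)) * x) =
      ∑ l, coord k e α i l c * coordMul k e α l j u v x := by
  induction x with
  | zero => simp
  | tmul y z => simp [coord_mul, Finset.sum_mul, mul_assoc]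
  | add x y hx hy => simp only [mul_add, map_add, hx, hy, Finset.sum_add_distrib]

theorem coordMul_one_tmul_mul (i j u v : Idx α) (x : A ⊗[k] A) (c : A) :
    coordMul k e α i j u v (((1 : A) ⊗ₜ[k] c) * x) =
      ∑ l, coord k e α u l c * coordMul k e α i j l v x := by
  induction x with
  | zero => simp
  | tmul y z => simp [coord_mul, Finset.mul_sum, mul_left_comm]
  | add x y hx hy => simp only [mul_add, map_add, hx, hy, Finset.sum_add_distrib]

theorem coordMul_comm (i j u v : Idx α) (x : A ⊗[k] A) :
    coordMul k e α i j u v (TensorProduct.comm k A A x) = coordMul k e α u v i j x := by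
  induction x with
  | zero => simp
  | tmul y z => simp [mul_comm]
  | add x y hx hy => simp only [map_add, hx, hy]

theorem derivation_ext {M : Type*} [AddCommGroup M] [Module k M] [Module (RepRing k e α) M]
    {D D' : Derivation k (RepRing k e α) M}
    (h : ∀ i j a, D (coord k e α i j a) = D' (coord k e α i j a)) : D = D' := by
  refine Derivation.ext_of_adjoin_eq_top _ adjoin_coord_eq_top ?_
  rintro _ ⟨a, i, j, rfl⟩
  exact h i j a

/-- The derivation `{x, -}` given by a skew biderivation. -/
def IsSkewBiderivation.toDerivation {S : Type*} [CommRing S] [Algebra k S]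
    {br : S →ₗ[k] S →ₗ[k] S} (h : IsSkewBiderivation br) (x : S) : Derivation k S S :=
  Derivation.mk' (br x) fun y z => by
    rw [h.leibniz, smul_eq_mul, smul_eq_mul]; ring

variable {dbr : A →ₗ[k] A →ₗ[k] A ⊗[k] A}

theorem IsRepBracket.unique {br br' : RepRing k e α →ₗ[k] RepRing k e α →ₗ[k] RepRing k e α}
    (h : IsRepBracket e α dbr br) (h' : IsRepBracket e α dbr br') : br' = br := by
  have h1 : ∀ i j a, h'.toDerivation (coord k e α i j a) = h.toDerivation (coord k e α i j a) :=
    fun i j a => derivation_ext fun u v b => (h'.apply_coord _ _ _ _ _ _).trans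
      (h.apply_coord _ _ _ _ _ _).symm
  have h2 : ∀ x, h'.toDerivation x = h.toDerivation x := fun x => derivation_ext fun i j a => by
    change br' x _ = br x _
    rw [h'.antisymm, h.antisymm]
    exact congrArg Neg.neg (DFunLike.congr_fun (h1 i j a) x)
  exact LinearMap.ext fun x => LinearMap.ext fun y => DFunLike.congr_fun (h2 x) y

/-- `exists_derivation` is used twice: with values in `R`, to get `D i j a = {aᵢⱼ, -}`, and then
with values in `Der(R)`, to extend `aᵢⱼ ↦ D i j a` to a derivation `E` of the first argument. -/
theorem IsDoubleBracket.exists_repBracket (h : IsDoubleBracket e dbr) (α : I → ℕ) :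
    ∃ br : RepRing k e α →ₗ[k] RepRing k e α →ₗ[k] RepRing k e α, IsRepBracket e α dbr br := by
  have h1 : ∀ (i j : Idx α) (a : A), ∃ D : Derivation k (RepRing k e α) (RepRing k e α),
      ∀ u v b, D (coord k e α u v b) = coordMul k e α u j i v (dbr a b) := fun i j a =>
    exists_derivation (fun u v => coordMul k e α u j i v ∘ₗ dbr a)
      (fun b c u v => by
        simp only [LinearMap.comp_apply, h.right_derivation, map_add, coordMul_mul_one_tmul,
          coordMul_tmul_one_mul, smul_eq_mul, Finset.sum_add_distrib]
        rw [add_comm]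
        simp only [mul_comm])
      (fun s u v => by simp [h.base_right])
  choose D hD using h1
  obtain ⟨E, hE⟩ := exists_derivation (k := k) (e := e) (α := α)
    (M := Derivation k (RepRing k e α) (RepRing k e α))
    (fun i j =>
      { toFun := D i j
        map_add' := fun a b => derivation_ext fun u v c => by
          simp only [Derivation.add_apply, hD, map_add, LinearMap.add_apply]
        map_smul' := fun r a => derivation_ext fun u v c => by
          simp only [Derivation.smul_apply, hD, map_smul, LinearMap.smul_apply,
            RingHom.id_apply] })
    (fun a b i j => derivation_ext fun u v c => by
      change D i j (a * b) _ = Derivation.coeFnAddMonoidHom (∑ l, _) _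
      rw [map_sum, Finset.sum_apply]
      change _ = ∑ l, (coord k e α i l a * D l j b (coord k e α u v c) +
        coord k e α l j b * D i l a (coord k e α u v c))
      simp only [hD, h.left_derivation, map_add, coordMul_mul_tmul_one, coordMul_one_tmul_mul,
        Finset.sum_add_distrib]
      rw [add_comm]
      simp only [mul_comm])
    (fun s i j => derivation_ext fun u v c => by
      change D i j (e s) _ = 0
      rw [hD, h.base_left, map_zero])
  have hE' : ∀ i j a u v b, E (coord k e α i j a) (coord k e α u v b) =
      coordMul k e α u j i v (dbr a b) := fun i j a u v b => by
    rw [hE]; exact hD i j a u v b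
  let br : RepRing k e α →ₗ[k] RepRing k e α →ₗ[k] RepRing k e α :=
    LinearMap.mk₂ k (fun x y => E x y) (fun x x' y => by rw [map_add]; rfl)
      (fun r x y => by rw [E.map_smul]; rfl) (fun x y y' => map_add _ _ _)
      (fun r x y => (E x).map_smul r y)
  -- `F y` is `-{-, y}`, so antisymmetry reads `E = F`. It holds on pairs of coordinates by cyclic
  -- antisymmetry and is extended one argument at a time.
  let F : RepRing k e α → Derivation k (RepRing k e α) (RepRing k e α) := fun y =>
    Derivation.mk' (-br.flip y) fun x x' => by
      change -(E (x * x') y) = x * -(E x' y) + x' * -(E x y)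
      rw [E.leibniz]
      change -(x * E x' y + x' * E x y) = _
      ring
  have hEF : ∀ x, E x = F x := by
    have h2 : ∀ i j a, F (coord k e α i j a) = E (coord k e α i j a) := fun i j a =>
      derivation_ext fun u v b => by
        change -(E (coord k e α u v b) (coord k e α i j a)) = _
        rw [hE', hE', h.cyclic_antisymm, map_neg, coordMul_comm, neg_neg]
    exact fun x => derivation_ext fun i j a => by
      have := DFunLike.congr_fun (h2 i j a) x
      change -(E x _) = _ at this
      change _ = -(E _ x)
      rw [← this, neg_neg]
  refine ⟨br, ⟨⟨fun x y => ?_, fun x y z => ?_⟩, fun a b i j u v => hE' i j a u v b⟩⟩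
  · exact DFunLike.congr_fun (hEF x) y
  · change E x (y * z) = E x y * z + y * E x z
    rw [Derivation.leibniz, smul_eq_mul, smul_eq_mul]; ring

variable (k e α) in
/-- The function `a ↦ tr 𝒳(a)`. -/
noncomputable def trCoord : A →ₗ[k] RepRing k e α := ∑ i, coord k e α i i

theorem trCoord_apply (a : A) : trCoord k e α a = ∑ i, coord k e α i i a := by
  simp [trCoord]

theorem trCoord_mul_comm (a b : A) : trCoord k e α (a * b) = trCoord k e α (b * a) := by
  simp only [trCoord_apply, coord_mul]
  rw [Finset.sum_comm]
  simp only [mul_comm]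

theorem IsRepBracket.apply_trCoord
    {br : RepRing k e α →ₗ[k] RepRing k e α →ₗ[k] RepRing k e α}
    (h : IsRepBracket e α dbr br) (a b : A) :
    br (trCoord k e α a) (trCoord k e α b) = trCoord k e α (LinearMap.mul' k A (dbr a b)) := by
  have key : ∀ x : A ⊗[k] A, ∑ i, ∑ u, coordMul k e α u i i u x =
      trCoord k e α (LinearMap.mul' k A x) := fun x => by
    induction x with
    | zero => simp
    | tmul y z =>
      simp only [coordMul_tmul, LinearMap.mul'_apply, trCoord_apply, coord_mul]
      rw [Finset.sum_comm]
    | add x y hx hy => simp only [map_add, Finset.sum_add_distrib, hx, hy]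
  rw [← key]
  simp only [trCoord_apply, map_sum, LinearMap.sum_apply, h.apply_coord]
  rw [Finset.sum_comm]

variable (k e α) in
/-- The map `x ⊗ y ⊗ z ↦ tr 𝒳(xyz)`. -/
noncomputable def trCoord₃ : (A ⊗[k] A) ⊗[k] A →ₗ[k] RepRing k e α :=
  trCoord k e α ∘ₗ LinearMap.mul' k A ∘ₗ LinearMap.rTensor A (LinearMap.mul' k A)

@[simp]
theorem trCoord₃_tmul (x y z : A) :
    trCoord₃ k e α (x ⊗ₜ[k] y ⊗ₜ[k] z) = trCoord k e α (x * y * z) := rfl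

theorem trCoord₃_tau (x : (A ⊗[k] A) ⊗[k] A) : trCoord₃ k e α (tau x) = trCoord₃ k e α x := by
  have : trCoord₃ k e α ∘ₗ tau = trCoord₃ k e α := by
    refine TensorProduct.ext_threefold fun x y z => ?_
    change trCoord k e α (z * x * y) = trCoord k e α (x * y * z)
    rw [mul_assoc, trCoord_mul_comm]
  exact DFunLike.congr_fun this x

/-- For `x = y ⊗ z`, the derivation rule gives a term ending in `z` and a term starting with `y`;
cyclicity of the trace moves `y` to the end, whence the swap. -/
theorem IsDoubleBracket.trCoord_mul'_apply_mul' (h : IsDoubleBracket e dbr) (a : A)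
    (x : A ⊗[k] A) :
    trCoord k e α (LinearMap.mul' k A (dbr a (LinearMap.mul' k A x))) =
      trCoord₃ k e α (bracketLeft dbr a x) +
        trCoord₃ k e α (bracketLeft dbr a (TensorProduct.comm k A A x)) := by
  have hr : ∀ (x : A ⊗[k] A) (c : A), LinearMap.mul' k A (x * ((1 : A) ⊗ₜ[k] c)) =
      LinearMap.mul' k A x * c := fun x c => by
    induction x with
    | zero => simp
    | tmul x y => simp [mul_assoc]
    | add x y hx hy => simp only [add_mul, map_add, hx, hy]
  have hl : ∀ (x : A ⊗[k] A) (c : A), LinearMap.mul' k A ((c ⊗ₜ[k] (1 : A)) * x) =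
      c * LinearMap.mul' k A x := fun x c => by
    induction x with
    | zero => simp
    | tmul x y => simp [mul_assoc]
    | add x y hx hy => simp only [mul_add, map_add, hx, hy]
  induction x with
  | zero => simp
  | tmul y z =>
    rw [LinearMap.mul'_apply, h.right_derivation, map_add, hr, hl, map_add,
      trCoord_mul_comm (e := e) (α := α) y]
    rfl
  | add x y hx hy => simp only [map_add, hx, hy]; abel

/-- After multiplication, four of the eight terms become `± c eₛ a eₛ b eₛ` and four become `± eₛ a
eₛ b eₛ c`, each with two signs of either kind. -/
theorem IsDoubleQuasiPoisson.trCoord₃_tripleBracket (h : IsDoubleQuasiPoisson e dbr)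
    (a b c : A) :
    trCoord₃ k e α (tripleBracket dbr a b c) = 0 := by
  rw [h.quasi_poisson, map_smul, map_sum, Finset.sum_eq_zero, smul_zero]
  intro s _
  simp only [map_add, map_sub, trCoord₃_tmul, mul_assoc]
  abel

theorem IsRepBracket.jacobiator_trCoord
    {br : RepRing k e α →ₗ[k] RepRing k e α →ₗ[k] RepRing k e α}
    (h : IsRepBracket e α dbr br) (hA : IsDoubleQuasiPoisson e dbr)
    (a b c : A) :
    jacobiator br (trCoord k e α a) (trCoord k e α b) (trCoord k e α c) = 0 := by
  have h1 : ∀ a b c : A, br (trCoord k e α a) (br (trCoord k e α b) (trCoord k e α c)) =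
      trCoord₃ k e α (bracketLeft dbr a (dbr b c)) -
        trCoord₃ k e α (bracketLeft dbr a (dbr c b)) := fun a b c => by
    rw [h.apply_trCoord, h.apply_trCoord, hA.trCoord_mul'_apply_mul', hA.cyclic_antisymm c b,
      map_neg, map_neg, sub_neg_eq_add]
  have h2 := hA.trCoord₃_tripleBracket (α := α) a b c
  have h3 := hA.trCoord₃_tripleBracket (α := α) a c b
  simp only [tripleBracket, map_add, trCoord₃_tau] at h2 h3
  rw [jacobiator, h1, h1, h1]
  -- The six terms of the Jacobiator split into the cyclic orders `(a, b, c)` and `(a, c, b)`, the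
  -- latter with sign `-1` from cyclic antisymmetry.
  linear_combination h2 - h3

end RepresentationSpaces

/-! ### The moment map on the fibre `𝒳(Φ) = 𝒳(q)`. -/

section RepresentationSpaces

variable {k : Type*} [Field k] {A : Type*} [Ring A] [Algebra k A]
variable {I : Type*} [Fintype I] [DecidableEq I] {e : I → A} {α : I → ℕ}

theorem coord_idem_mul (s : I) (i j : Idx α) (a : A) :
    coord k e α i j (e s * a) = if i.1 = s then coord k e α i j a else 0 := by
  simp only [coord_mul, coord_idem, ite_mul, one_mul, zero_mul, ite_and, Finset.sum_ite_eq,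
    Finset.mem_univ, if_true]

theorem coord_mul_idem (s : I) (i j : Idx α) (a : A) :
    coord k e α i j (a * e s) = if j.1 = s then coord k e α i j a else 0 := by
  simp only [coord_mul, coord_idem, mul_ite, mul_one, mul_zero, ite_and, Finset.sum_ite_eq',
    Finset.mem_univ, if_true]

theorem coord_sum_smul_idem (q : I → kˣ) (i j : Idx α) :
    coord k e α i j (∑ s, (q s : k) • e s) =
      if i = j then algebraMap k (RepRing k e α) (q i.1) else 0 := by
  simp only [map_sum, map_smul, coord_idem, ite_and, smul_ite, smul_zero]
  split_ifs
  · simp [Algebra.algebraMap_eq_smul_one]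
  · simp

variable {Φ : A} {q : I → kˣ}

theorem redMap_eq_zero_iff {x : RepRing k e α} :
    redMap e α Φ q x = 0 ↔ x ∈ momentIdeal e α Φ q :=
  Ideal.Quotient.eq_zero_iff_mem

theorem redMap_coord_moment (i j : Idx α) :
    redMap e α Φ q (coord k e α i j Φ) =
      redMap e α Φ q (coord k e α i j (∑ s, (q s : k) • e s)) := by
  rw [← sub_eq_zero, ← map_sub, redMap_eq_zero_iff]
  exact Ideal.subset_span ⟨i, j, rfl⟩

section MomentFibre

variable {Q : Type*} [CommRing Q] [Algebra k Q] {π : RepRing k e α →ₐ[k] Q}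

theorem map_coord_moment_component
    (hπ : ∀ i j, π (coord k e α i j Φ) = π (coord k e α i j (∑ s, (q s : k) • e s)))
    (s : I) (i j : Idx α) :
    π (coord k e α i j (e s * Φ * e s)) =
      if i = j then if i.1 = s then algebraMap k Q (q s) else 0 else 0 := by
  rw [coord_mul_idem, coord_idem_mul, apply_ite π, apply_ite π, hπ,
    coord_sum_smul_idem, apply_ite π, map_zero, π.commutes]
  by_cases hij : i = j
  · subst hij
    by_cases his : i.1 = s
    · subst his; simp
    · simp [his]
  · simp [hij]

variable {dbr : A →ₗ[k] A →ₗ[k] A ⊗[k] A}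
  {br : RepRing k e α →ₗ[k] RepRing k e α →ₗ[k] RepRing k e α}

/-- On the moment fibre, the matrix entries of the moment map generate the infinitesimal
action. -/
theorem IsQuasiHamiltonian.map_bracket_moment [CharZero k] (hA : IsQuasiHamiltonian e dbr Φ)
    (hπ : ∀ i j, π (coord k e α i j Φ) = π (coord k e α i j (∑ s, (q s : k) • e s)))
    (h : IsRepBracket e α dbr br) (i j u v : Idx α) (b : A) :
    π (br (coord k e α i j Φ) (coord k e α u v b)) =
      if j.1 = i.1 then algebraMap k Q (q i.1) *
        ((if i = v then π (coord k e α u j b) else 0)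
          - (if u = j then π (coord k e α i v b) else 0)) else 0 := by
  have hs : ∀ s, π (coordMul k e α u j i v (dbr (e s * Φ * e s) b)) =
      if i.1 = s then if j.1 = s then algebraMap k Q (q s) *
        ((if i = v then π (coord k e α u j b) else 0)
          - (if u = j then π (coord k e α i v b) else 0)) else 0 else 0 := by
    intro s
    have hl : π (coord k e α i v (e s * Φ * e s * b)) =
        if i.1 = s then algebraMap k Q (q s) * π (coord k e α i v b) else 0 := by
      rw [coord_mul]
      simp only [map_sum, map_mul, map_coord_moment_component hπ, ite_mul, zero_mul,
        Finset.sum_ite_eq, Finset.mem_univ, if_true]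
    have hr : π (coord k e α u j (b * (e s * Φ * e s))) =
        if j.1 = s then π (coord k e α u j b) * algebraMap k Q (q s) else 0 := by
      rw [coord_mul]
      simp only [map_sum, map_mul, map_coord_moment_component hπ, mul_ite, mul_zero,
        Finset.sum_ite_eq', Finset.mem_univ, if_true]
    -- Once `Φₛ` becomes `qₛ eₛ` on the fibre, the four terms of the moment condition coincide in
    -- pairs, which cancels the factor `1 / 2`.
    have half : ∀ x y : Q, x = y + y → (1 / 2 : k) • x = y := fun x y hxy => by
      rw [hxy, ← two_smul k y, smul_smul]; norm_num
    rw [hA.moment, map_smul, map_smul]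
    apply half
    simp only [map_add, map_sub, coordMul_tmul, map_mul, hl, hr, map_coord_moment_component hπ]
    simp only [coord_mul_idem, coord_idem_mul, coord_idem, apply_ite π, map_zero, map_one]
    by_cases hiv : i = v
    · subst hiv
      by_cases huj : u = j
      · subst huj
        by_cases hi : i.1 = s <;> by_cases hj : u.1 = s <;> simp [hi, hj] <;> ring
      · by_cases hi : i.1 = s <;> by_cases hj : j.1 = s <;> simp [hi, hj, huj] <;> ring
    · by_cases huj : u = j
      · subst huj
        by_cases hi : i.1 = s <;> by_cases hj : u.1 = s <;> simp [hi, hj, hiv] <;> ring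
      · simp [hiv, huj]
  have hΦ : dbr Φ b = ∑ s, dbr (e s * Φ * e s) b := by
    conv_lhs => rw [hA.diagonal]
    rw [map_sum, LinearMap.sum_apply]
  rw [h.apply_coord, hΦ, map_sum, map_sum]
  simp only [hs, Finset.sum_ite_eq, Finset.mem_univ, if_true]

/-- Traces are invariant under conjugation: summing over `u = v`, both terms of the action become
`bᵢⱼ`. -/
theorem IsQuasiHamiltonian.map_bracket_moment_trCoord [CharZero k]
    (hA : IsQuasiHamiltonian e dbr Φ)
    (hπ : ∀ i j, π (coord k e α i j Φ) = π (coord k e α i j (∑ s, (q s : k) • e s)))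
    (h : IsRepBracket e α dbr br) (i j : Idx α) (b : A) :
    π (br (coord k e α i j Φ) (trCoord k e α b)) = 0 := by
  rw [trCoord_apply, map_sum, map_sum]
  simp only [hA.map_bracket_moment hπ h]
  split_ifs
  · rw [← Finset.mul_sum, Finset.sum_sub_distrib]
    simp
  · simp

/-- The action is linear in the entries of `b`. Taking `b = Φ - q` yields `{J_q, J_q} ⊆ J_q`. -/
theorem IsQuasiHamiltonian.map_bracket_moment_eq_zero [CharZero k]
    (hA : IsQuasiHamiltonian e dbr Φ)
    (hπ : ∀ i j, π (coord k e α i j Φ) = π (coord k e α i j (∑ s, (q s : k) • e s)))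
    (h : IsRepBracket e α dbr br) {b : A} (hb : ∀ u v, π (coord k e α u v b) = 0)
    (i j u v : Idx α) : π (br (coord k e α i j Φ) (coord k e α u v b)) = 0 := by
  rw [hA.map_bracket_moment hπ h]
  simp only [hb, ite_self, sub_self, mul_zero]

end MomentFibre

end RepresentationSpaces

end QuasiHamiltonian

open QuasiHamiltonian in
theorem mainTheorem11 {k : Type*} [Field k] [CharZero k]
    {A : Type*} [Ring A] [Algebra k A] [Algebra.FiniteType k A]
    {I : Type*} [Fintype I] [DecidableEq I]
    (e : I → A) (he : CompleteOrthogonalIdempotents e)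
    (dbr : A →ₗ[k] A →ₗ[k] TensorProduct k A A) (Φ : A)
    (hA : QuasiHamiltonian.IsQuasiHamiltonian e dbr Φ)
    (α : I → ℕ) (q : I → kˣ) :
    ∃ br : QuasiHamiltonian.RepRing k e α →ₗ[k] QuasiHamiltonian.RepRing k e α →ₗ[k]
        QuasiHamiltonian.RepRing k e α,
      QuasiHamiltonian.IsRepBracket e α dbr br ∧
      (∀ br', QuasiHamiltonian.IsRepBracket e α dbr br' → br' = br) ∧
      ∃! pb : QuasiHamiltonian.traceAlgebra e α Φ q →ₗ[k]
          QuasiHamiltonian.traceAlgebra e α Φ q →ₗ[k] QuasiHamiltonian.traceAlgebra e α Φ q,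
        QuasiHamiltonian.IsPoissonBracket (k := k) (S := QuasiHamiltonian.traceAlgebra e α Φ q) pb ∧
        ∀ (x y : QuasiHamiltonian.RepRing k e α)
          (hx : QuasiHamiltonian.redMap e α Φ q x ∈ QuasiHamiltonian.traceAlgebra e α Φ q)
          (hy : QuasiHamiltonian.redMap e α Φ q y ∈ QuasiHamiltonian.traceAlgebra e α Φ q),
          ((pb ⟨_, hx⟩ ⟨_, hy⟩ : QuasiHamiltonian.traceAlgebra e α Φ q) :
              QuasiHamiltonian.RedRing e α Φ q) =
            QuasiHamiltonian.redMap e α Φ q (br x y) := by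
  obtain ⟨br, h⟩ := hA.exists_repBracket α
  -- The entries of `𝒳(q)` are scalars, so a generator of `J_q` has the same brackets as the entry
  -- of `𝒳(Φ)` in it.
  have hbase : ∀ (i j : Idx α) (x : RepRing k e α),
      br (coord k e α i j (∑ s, (q s : k) • e s)) x = 0 := fun i j x => by
    rw [coord_sum_smul_idem]
    split_ifs
    · exact h.map_algebraMap_left _ _
    · rw [map_zero, LinearMap.zero_apply]
  have hgen : ∀ (i j : Idx α) (x : RepRing k e α),
      br ((repMatrix k e α Φ - repMatrix k e α (∑ s, (q s : k) • e s)) i j) x =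
        br (coord k e α i j Φ) x := fun i j x => by
    change br (coord k e α i j Φ - coord k e α i j (∑ s, (q s : k) • e s)) x = _
    rw [map_sub, LinearMap.sub_apply, hbase, sub_zero]
  refine ⟨br, h, fun br' h' => h.unique h', ?_⟩
  refine h.existsUnique_reduced (s := Set.range (trCoord k e α)) (J := momentIdeal e α Φ q) rfl
    ?_ ?_ ?_ ?_ ?_
  · rintro _ ⟨a, rfl⟩ _ ⟨b, rfl⟩
    rw [h.apply_trCoord]
    exact Algebra.subset_adjoin ⟨_, rfl⟩
  · rintro _ ⟨a, rfl⟩ _ ⟨b, rfl⟩ _ ⟨c, rfl⟩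
    exact h.jacobiator_trCoord hA.toIsDoubleQuasiPoisson a b c
  · rintro _ ⟨i, j, rfl⟩ _ ⟨b, rfl⟩
    rw [hgen, ← redMap_eq_zero_iff]
    exact hA.map_bracket_moment_trCoord (Q := RedRing e α Φ q) (π := redMap e α Φ q)
      redMap_coord_moment h i j b
  · rintro _ ⟨i, j, rfl⟩ _ ⟨u, v, rfl⟩
    have hzero : ∀ u v : Idx α,
        redMap e α Φ q (coord k e α u v (Φ - ∑ s, (q s : k) • e s)) = 0 := fun u v => by
      rw [map_sub, map_sub, redMap_coord_moment, sub_self]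
    have huv : (repMatrix k e α Φ - repMatrix k e α (∑ s, (q s : k) • e s)) u v =
        coord k e α u v (Φ - ∑ s, (q s : k) • e s) := by rw [map_sub]; rfl
    rw [hgen, huv, ← redMap_eq_zero_iff]
    exact hA.map_bracket_moment_eq_zero (Q := RedRing e α Φ q) (π := redMap e α Φ q)
      redMap_coord_moment h hzero i j u v
  · rw [traceAlgebra, AlgHom.map_adjoin, ← Set.range_comp]
    congr 2
    ext a
    simp only [Function.comp_apply, trCoord_apply]
    rfl
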